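/- **Conventions.** $\mathbb N=\{1,2,3,\dots\}$. For $M\subseteq\mathbb N$, $[M]^{<\omega}$ is the set of finite subsets of $M$ and $[M]$ the set of infinite subsets of $M$; $s<t$ means that every element of $s$ is smaller than every element of $t$. Sets of natural numbers are identified with their characteristic functions and carry the topology of pointwise convergence. A family $\mathcal F\subseteq[\mathbb N]^{<\omega}$ is *hereditary* if it contains every subset of each of its members, and $\mathcal F^{\star}$ denotes the family consisting of $\emptyset$ and of all initial segments of members of $\mathcal F$. **Strong Cantor–Bendixson index.** For $\mathcal F\subseteq[\mathbb N]^{<\omega}$ and $M\in[\mathbb N]$ let $(\mathcal F)^1_M$ be the set of all $F\in\mathcal F\cap[M]^{<\omega}$ such that, for each $L\in[M]$, $F$ is a cluster point of $\mathcal F\cap[F\cup L]^{<\omega}$ (every neighbourhood of $F$ contains a member of that family other than $F$). Put $(\mathcal F)^{\xi+1}_M=((\mathcal F)^{\xi}_M)^1_M$, and $(\mathcal F)^{\xi}_M=\bigcap_{1\le\beta<\xi}(\mathcal F)^\beta_M$ for limit $\xi$. The index $s_M(\mathcal F)$ is the least countable ordinal $\xi\ge1$ with $(\mathcal F)^\xi_M=\emptyset$.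 **The system $(\mathcal A_\xi)_{\xi<\omega_1}$.** For every nonzero countable limit ordinal $\lambda$ fix a strictly increasing sequence $(\lambda_n)_{n\in\mathbb N}$ of successor ordinals smaller than $\lambda$ with $\sup_n\lambda_n=\lambda$. Define: - $\mathcal A_0=\{\emptyset\}$; - $\mathcal A_{\zeta+1}=\{\{n\}\cup s: n\in\mathbb N,\ s\in\mathcal A_\zeta,\ \{n\}<s\}$; - $\mathcal A_{\omega^{\beta+1}}=\{s_1\cup\dots\cup s_n: n=\min s_1,\ s_1<\dots<s_n,\ s_i\in\mathcal A_{\omega^\beta}\}$; - $\mathcal A_{\omega^\lambda}=\{s\neq\emptyset: s\in\mathcal A_{\omega^{\lambda_n}}\text{ for }n=\min s\}$ for $\lambda$ a nonzero limit; - for any other limit ordinal $\xi$, with Cantor normal form $\xi=\omega^{e_1}+\dots+\omega^{e_k}$, $e_1\ge\dots\ge e_k>0$: $\mathcal A_\xi=\{s_k\cup\dots\cup s_1: s_k<\dots<s_1,\ s_i\in\mathcal A_{\omega^{e_i}}\}$. **Theorem 3.7 (= Theorem B).** The following holds for every choice of the sequences $(\lambda_n)$. Let $\mathcal F$ be a hereditary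 family of finite subsets of $\mathbb N$ and let $M$ be an infinite subset of $\mathbb N$. **Case 1.** If $\mathcal F\cap[M]^{<\omega}$ is not pointwise closed, then there is $L\in[M]$ with $[L]^{<\omega}\subseteq\mathcal F$. **Case 2.** If $\mathcal F\cap[M]^{<\omega}$ is pointwise closed, then $s_L(\mathcal F)$ exists for every $L\in[M]$, the supremum $\xi^{\mathcal F}_M=\sup\{s_L(\mathcal F):L\in[M]\}$ is a countable ordinal, and for every countable ordinal $\xi$: - (i) if $\xi+1<\xi^{\mathcal F}_M$, then there is $L\in[M]$ with $\mathcal A_\xi\cap[L]^{<\omega}\subseteq\mathcal F$; - (ii) if $\xi^{\mathcal F}_M<\xi+1$, then for every $I\in[M]$ there is $L\in[I]$ with $\mathcal A_\xi\cap[L]^{<\omega}\subseteq[\mathbb N]^{<\omega}\setminus\mathcal F$; moreover, for every $L\in[M]$ this inclusion is equivalent to $\mathcal F\cap[L]^{<\omega}\subseteq(\mathcal A_\xi)^{\star}\setminus\mathcal A_\xi$; - (iii) if $\xi^{\mathcal F}_M=\xi+1$, then there is $L\in[M]$ with either $\mathcal A_\xi\cap[L]^{<\omega}\subseteq\mathcal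 F$ or $\mathcal A_\xi\cap[L]^{<\omega}\subseteq[\mathbb N]^{<\omega}\setminus\mathcal F$. Both alternatives in (iii) may materialize: there are an infinite $M\subseteq\mathbb N$, a countable ordinal $\xi$ and non-empty hereditary families $\mathcal F_1,\mathcal F_2\subseteq[\mathbb N]^{<\omega}$ such that, for $j=1,2$, $\mathcal F_j\cap[M]^{<\omega}$ is pointwise closed and $\xi^{\mathcal F_j}_M=\xi+1$, and such that for every $L\in[M]$ one has $\mathcal A_\xi\cap[L]^{<\omega}\subseteq\mathcal F_1$ and $\mathcal A_\xi\cap[L]^{<\omega}\subseteq[\mathbb N]^{<\omega}\setminus\mathcal F_2$. -/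

import Mathlib

open Set Filter Topology

namespace ThinSchreier

/-! The natural numbers are the positive integers `ℕ+`.  Families of finite sets are terms of
type `Set (Finset ℕ+)`. -/

/-- `[M]^{<ω}`: the finite subsets of `M`. -/
def finSubsets (M : Set ℕ+) : Set (Finset ℕ+) := {s | (s : Set ℕ+) ⊆ M}

/-- `[M]`: the infinite subsets of `M`. -/
def infSubsets (M : Set ℕ+) : Set (Set ℕ+) := {L | L ⊆ M ∧ L.Infinite}

/-- `F_⋆`: all subsets of members of `F`. -/
def downClosure (F : Set (Finset ℕ+)) : Set (Finset ℕ+) := {t | ∃ s ∈ F, t ⊆ s}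

/-- `F` is hereditary if `F_⋆ = F`. -/
def IsHereditary (F : Set (Finset ℕ+)) : Prop := downClosure F = F

/-- `t` is an initial segment of `s` (not necessarily proper). -/
def IsInitialSegment (t s : Finset ℕ+) : Prop := t ⊆ s ∧ ∀ x ∈ t, ∀ y ∈ s, y ≤ x → y ∈ t

/-- `F^⋆`: all initial segments of members of `F`, together with the empty set. -/
def initialSegments (F : Set (Finset ℕ+)) : Set (Finset ℕ+) :=
  {t | ∃ s ∈ F, IsInitialSegment t s} ∪ {∅}

/-! ### Topology of pointwise convergence -/

/-- The characteristic function of a finite set, a point of the space `ℕ+ → Bool`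
(product of discrete two-point spaces) of all subsets of `ℕ+`. -/
def charFun (s : Finset ℕ+) : ℕ+ → Bool := fun n => decide (n ∈ s)

/-- `F` is closed in the space of all (finite or infinite) subsets of `ℕ+`. -/
def PointwiseClosed (F : Set (Finset ℕ+)) : Prop := IsClosed (charFun '' F)

/-- `s` is a cluster point of `F`: every neighbourhood of `s` contains a member of `F`
different from `s`. -/
def IsClusterPt (s : Finset ℕ+) (F : Set (Finset ℕ+)) : Prop :=
  AccPt (charFun s) (𝓟 (charFun '' F))

/-! ### Strong Cantor-Bendixson index -/

/-- One strong Cantor-Bendixson derivative of `F` on `M`. -/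
def strongDeriv (F : Set (Finset ℕ+)) (M : Set ℕ+) : Set (Finset ℕ+) :=
  {s | s ∈ F ∩ finSubsets M ∧
    ∀ L ∈ infSubsets M, IsClusterPt s (F ∩ finSubsets ((s : Set ℕ+) ∪ L))}

/-- The strong Cantor-Bendixson derivative of order `ξ` of `F` on `M`; the derivative of order `0`
is the restriction of `F` to `M`, and the one of order `1` is `strongDeriv F M`. -/
noncomputable def strongDerivIter (F : Set (Finset ℕ+)) (M : Set ℕ+) (ξ : Ordinal.{0}) :
    Set (Finset ℕ+) :=
  Ordinal.limitRecOn (motive := fun _ => Set (Finset ℕ+)) ξ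
    (F ∩ finSubsets M)
    (fun _ G => strongDeriv G M)
    (fun η _ G => {s | ∀ (β : Ordinal.{0}) (h : β < η), s ∈ G β h})

/-- The strong Cantor-Bendixson index `s_M(F)`: the least `ξ ≥ 1` such that the derivative of
order `ξ` of `F` on `M` is empty. -/
noncomputable def strongIndex (F : Set (Finset ℕ+)) (M : Set ℕ+) : Ordinal.{0} :=
  sInf {ξ | 1 ≤ ξ ∧ strongDerivIter F M ξ = ∅}

/-- `sup {s_L(F) : L ∈ [M]}`. -/
noncomputable def supIndex (F : Set (Finset ℕ+)) (M : Set ℕ+) : Ordinal.{0} :=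
  ⨆ L : infSubsets M, strongIndex F (L : Set ℕ+)

/-! ### The complete thin Schreier system -/

/-- A choice, for every nonzero countable limit ordinal `δ`, of a strictly increasing sequence
of successor ordinals below `δ` with supremum `δ`. -/
structure LadderSystem where
  seq : Ordinal.{0} → ℕ+ → Ordinal.{0}
  strictMono : ∀ δ, Order.IsSuccLimit δ → δ < Ordinal.omega 1 → StrictMono (seq δ)
  isSucc : ∀ δ, Order.IsSuccLimit δ → δ < Ordinal.omega 1 → ∀ n, ∃ μ, seq δ n = μ + 1
  lt : ∀ δ, Order.IsSuccLimit δ → δ < Ordinal.omega 1 → ∀ n, seq δ n < δ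
  isLUB : ∀ δ, Order.IsSuccLimit δ → δ < Ordinal.omega 1 → IsLUB (Set.range (seq δ)) δ

/-- All unions `s₁ ∪ ⋯ ∪ sₖ` with `s₁ < ⋯ < sₖ` and `sᵢ ∈ Gᵢ`, for a list `[G₁, …, Gₖ]` of
families. -/
def blockUnions : List (Set (Finset ℕ+)) → Set (Finset ℕ+)
  | [] => {∅}
  | G :: Gs => {s | ∃ t ∈ G, ∃ u ∈ blockUnions Gs, (∀ x ∈ t, ∀ y ∈ u, x < y) ∧ s = t ∪ u}

/-- The families `B_α = A_{ω^α}`: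
* `B_0 = A_1` consists of the singletons;
* `B_{β+1}` consists of the unions of `n` consecutive members of `B_β`, where `n` is the minimum of
  the union;
* for a limit ordinal `δ`, `s ∈ B_δ` if and only if `s ∈ B_{δ_n}` with `n = min s`. -/
noncomputable def powerFamily (c : LadderSystem) (α : Ordinal.{0}) : Set (Finset ℕ+) :=
  Ordinal.limitRecOn (motive := fun _ => Set (Finset ℕ+)) α
    {s | ∃ n : ℕ+, s = {n}}
    (fun _ B => {s | ∃ h : s.Nonempty, s ∈ blockUnions (List.replicate (s.min' h : ℕ) B)})
    (fun δ _ B => {s | ∃ (h : s.Nonempty) (hlt : c.seq δ (s.min' h) < δ),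
      s ∈ B (c.seq δ (s.min' h)) hlt})

/-- The complete thin Schreier system `A_ξ`.  For a limit ordinal `ξ`, write
`ξ = ω^{e₁} + ⋯ + ω^{eₖ}` with `e₁ ≥ ⋯ ≥ eₖ > 0` (Cantor normal form, each exponent repeated
according to its coefficient); then `A_ξ` consists of the unions `sₖ ∪ ⋯ ∪ s₁` with
`sₖ < ⋯ < s₁` and `sᵢ ∈ B_{eᵢ}`. In particular `A_{ω^α} = B_α`. -/
noncomputable def schreier (c : LadderSystem) (ξ : Ordinal.{0}) : Set (Finset ℕ+) :=
  Ordinal.limitRecOn (motive := fun _ => Set (Finset ℕ+)) ξ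
    {∅}
    (fun _ A => {s | ∃ n : ℕ+, ∃ t ∈ A, (∀ x ∈ t, n < x) ∧ s = insert n t})
    (fun η _ _ => {s | ∃ e : List Ordinal.{0}, e.Pairwise (fun a b => b ≤ a) ∧ (∀ a ∈ e, 0 < a) ∧
      η = (e.map (fun a => Ordinal.omega0 ^ a)).sum ∧
      s ∈ blockUnions (e.reverse.map (powerFamily c))})

end ThinSchreier

open ThinSchreier

/-! Two recursions match. For a hereditary family, `s` survives one derivation on `M` exactly when
`insert n s` stays in the family for all but finitely many `n ∈ M` (`mem_strongDeriv_iff`). The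
section of `schreier c ξ` at `n` is again a Schreier family, of order `f n < ξ`, where `f n`
eventually exceeds any given `β < ξ` (`exists_section_schreier`, from Cantor normal forms).
Inductions on `ξ` therefore run through sections.

Such an induction with a diagonal argument gives the Ramsey dichotomy `exists_homogeneous`: some
infinite `L` has all of `schreier c ξ` on `L` inside `F`, or all of it outside. Two further
inductions read off the index: inclusion keeps `∅` alive through `ξ` derivations (here the
cofinality of `f` matters), and avoidance kills everything at order `ξ + 1`. So (i) and (ii) each
exclude one alternative, and (iii) is the bare dichotomy.

Closedness makes one-point end extension well-founded, and its countable rank bounds all indices at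
once. For sharpness take `ξ = ω`: members of `schreier c ω` satisfy `card = min`, so they lie in the
family `card ≤ min` and outside the family `card < min`, while both families have index `ω + 1`. -/

namespace ThinSchreier

/-! ### Strong derivatives of hereditary families -/

section Hereditary

variable {F G : Set (Finset ℕ+)} {L M : Set ℕ+} {s t : Finset ℕ+}

theorem isHereditary_iff : IsHereditary F ↔ ∀ s ∈ F, ∀ t ⊆ s, t ∈ F := by
  constructor
  · intro h s hs t hts
    rw [← h]
    exact ⟨s, hs, hts⟩
  · intro h
    refine subset_antisymm ?_ fun s hs => ⟨s, hs, subset_rfl⟩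
    rintro t ⟨s, hs, hts⟩
    exact h s hs t hts

theorem IsHereditary.mem (h : IsHereditary F) (hs : s ∈ F) (hts : t ⊆ s) : t ∈ F :=
  isHereditary_iff.1 h s hs t hts

theorem isHereditary_finSubsets (M : Set ℕ+) : IsHereditary (finSubsets M) :=
  isHereditary_iff.2 fun _ hs _ hts _ hx => hs (hts hx)

theorem IsHereditary.inter (hF : IsHereditary F) (hG : IsHereditary G) : IsHereditary (F ∩ G) :=
  isHereditary_iff.2 fun _ hs _ hts => ⟨hF.mem hs.1 hts, hG.mem hs.2 hts⟩

theorem insert_mem_finSubsets {n : ℕ+} (hn : n ∈ M) (hs : s ∈ finSubsets M) :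
    insert n s ∈ finSubsets M := by
  intro x hx
  rcases Finset.mem_insert.1 (Finset.mem_coe.1 hx) with rfl | hx
  exacts [hn, hs hx]

theorem finSubsets_mono (h : L ⊆ M) : finSubsets L ⊆ finSubsets M :=
  fun _ hs => hs.trans h

theorem empty_mem_finSubsets (M : Set ℕ+) : ∅ ∈ finSubsets M := by
  simp [finSubsets]

theorem charFun_injective : Function.Injective charFun := by
  intro s t h
  ext n
  simpa [charFun] using congrFun h n

/-- Membership in a finite set is an open condition. -/
theorem setOf_subset_mem_nhds (s : Finset ℕ+) :
    {x : ℕ+ → Bool | ∀ i ∈ s, x i = true} ∈ 𝓝 (charFun s) := by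
  have : {x : ℕ+ → Bool | ∀ i ∈ s, x i = true} =
      (s : Set ℕ+).pi (fun _ => ({true} : Set Bool)) := by
    ext x; simp [Set.pi]
  rw [this]
  refine set_pi_mem_nhds s.finite_toSet fun i hi => ?_
  exact (isOpen_discrete _).mem_nhds (by simpa [charFun] using hi)

/-- Every neighbourhood of `x` contains all points agreeing with `x` up to some bound. -/
theorem exists_bound_of_mem_nhds {x : ℕ+ → Bool} {U : Set (ℕ+ → Bool)} (hU : U ∈ 𝓝 x) :
    ∃ m : ℕ+, ∀ y : ℕ+ → Bool, (∀ i ≤ m, y i = x i) → y ∈ U := by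
  rw [nhds_pi, Filter.mem_pi] at hU
  obtain ⟨I, hI, V, hV, hVU⟩ := hU
  obtain ⟨m, hm⟩ := hI.bddAbove
  refine ⟨m, fun y hy => hVU fun i hi => ?_⟩
  rw [hy i (hm hi)]
  exact mem_of_mem_nhds (hV i)

/-- The points agreeing with `x` up to a bound form a neighbourhood of `x`. -/
theorem setOf_agree_mem_nhds (x : ℕ+ → Bool) (m : ℕ+) :
    {y : ℕ+ → Bool | ∀ i ≤ m, y i = x i} ∈ 𝓝 x := by
  have : {y : ℕ+ → Bool | ∀ i ≤ m, y i = x i} = (Set.Iic m).pi (fun i => ({x i} : Set Bool)) := by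
    ext y; simp [Set.pi]
  rw [this]
  exact set_pi_mem_nhds (Set.finite_Iic m) fun i _ => (isOpen_discrete _).mem_nhds rfl

theorem exists_mem_gt (hM : M.Infinite) (m : ℕ+) : ∃ n ∈ M, m < n := by
  by_contra! h
  exact hM ((Set.finite_Iic m).subset fun n hn => h n hn)

theorem infinite_inter_Ioi (hM : M.Infinite) (m : ℕ+) : (M ∩ Ioi m).Infinite := by
  refine (hM.sdiff (Set.finite_Iic m)).mono fun n hn => ⟨hn.1, ?_⟩
  simpa using hn.2

theorem exists_forall_lt (s : Finset ℕ+) : ∃ m : ℕ+, ∀ x ∈ s, x < m := by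
  obtain ⟨m, hm⟩ := s.finite_toSet.bddAbove
  exact ⟨m + 1, fun x hx => (hm hx).trans_lt (PNat.lt_add_right m 1)⟩

/-- If the exceptional `n` formed an infinite set, take that set as `L`: a member of `G` near `s`
and different from it would contain `s` and some exceptional `n`, so heredity would put `insert n s`
in `G`. Conversely, the sets `insert n s` with large `n ∈ L` converge to `s`. -/
theorem mem_strongDeriv_iff (hG : IsHereditary G) (hM : M.Infinite) :
    s ∈ strongDeriv G M ↔ s ∈ finSubsets M ∧ {n ∈ M | insert n s ∉ G}.Finite := by
  constructor
  · rintro ⟨⟨hsG, hsM⟩, h⟩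
    refine ⟨hsM, ?_⟩
    by_contra hinf
    have := h {n ∈ M | insert n s ∉ G} ⟨fun n hn => hn.1, hinf⟩
    rw [IsClusterPt, accPt_iff_nhds] at this
    obtain ⟨_, ⟨hy, t, ⟨htG, hts⟩, rfl⟩, hne⟩ := this _ (setOf_subset_mem_nhds s)
    have hst : s ⊆ t := fun i hi => by simpa [charFun] using hy i hi
    have hne' : s ≠ t := fun h => hne (by rw [h])
    obtain ⟨n, hnt, hns⟩ := Finset.exists_of_ssubset (hst.ssubset_of_ne hne')
    rcases hts (Finset.mem_coe.2 hnt) with hn | hn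
    · exact hns hn
    · exact hn.2 (hG.mem htG (Finset.insert_subset hnt hst))
  · rintro ⟨hsM, hfin⟩
    have key : ∀ L ∈ infSubsets M, ∀ m, ∃ n ∈ L, m < n ∧ n ∉ s ∧ insert n s ∈ G := by
      intro L hL m
      have := ((hL.2.sdiff hfin).sdiff s.finite_toSet)
      obtain ⟨n, ⟨⟨hn1, hn2⟩, hn3⟩, hmn⟩ := exists_mem_gt this m
      refine ⟨n, hn1, hmn, by simpa using hn3, ?_⟩
      by_contra hn
      exact hn2 ⟨hL.1 hn1, hn⟩
    refine ⟨⟨?_, hsM⟩, fun L hL => ?_⟩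
    · obtain ⟨n, -, -, -, h⟩ := key M ⟨subset_rfl, hM⟩ 1
      exact hG.mem h (Finset.subset_insert _ _)
    · rw [IsClusterPt, accPt_iff_nhds]
      intro U hU
      obtain ⟨m, hm⟩ := exists_bound_of_mem_nhds hU
      obtain ⟨n, hnL, hmn, hns, hnG⟩ := key L hL m
      refine ⟨charFun (insert n s), ⟨hm _ fun i hi => ?_, _, ⟨hnG, ?_⟩, rfl⟩, fun h => ?_⟩
      · have : i ≠ n := (hi.trans_lt hmn).ne
        simp [charFun, this]
      · intro x hx
        rcases Finset.mem_insert.1 (Finset.mem_coe.1 hx) with rfl | hx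
        exacts [Or.inr hnL, Or.inl hx]
      · have := charFun_injective h
        exact hns (this ▸ Finset.mem_insert_self n s)

theorem isHereditary_strongDeriv (hG : IsHereditary G) (hM : M.Infinite) :
    IsHereditary (strongDeriv G M) := by
  refine isHereditary_iff.2 fun s hs t hts => ?_
  rw [mem_strongDeriv_iff hG hM] at hs ⊢
  exact ⟨fun x hx => hs.1 (hts hx), hs.2.subset fun n hn => ⟨hn.1, fun h =>
    hn.2 (hG.mem h (Finset.insert_subset_insert n hts))⟩⟩

theorem strongDerivIter_zero (F : Set (Finset ℕ+)) (M : Set ℕ+) :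
    strongDerivIter F M 0 = F ∩ finSubsets M := by
  rw [strongDerivIter, Ordinal.limitRecOn_zero]

theorem strongDerivIter_add_one (F : Set (Finset ℕ+)) (M : Set ℕ+) (ξ : Ordinal.{0}) :
    strongDerivIter F M (ξ + 1) = strongDeriv (strongDerivIter F M ξ) M := by
  rw [strongDerivIter, Ordinal.limitRecOn_add_one, strongDerivIter]

theorem mem_strongDerivIter_limit {ξ : Ordinal.{0}} (hξ : Order.IsSuccLimit ξ) :
    s ∈ strongDerivIter F M ξ ↔ ∀ β < ξ, s ∈ strongDerivIter F M β := by
  rw [strongDerivIter, Ordinal.limitRecOn_limit _ _ _ _ hξ]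
  rfl

theorem strongDerivIter_antitone (F : Set (Finset ℕ+)) (M : Set ℕ+) :
    Antitone (strongDerivIter F M) := by
  intro β ξ h
  induction ξ using Ordinal.limitRecOn with
  | zero => rw [nonpos_iff_eq_zero.1 h]
  | add_one ξ ih =>
    rcases h.lt_or_eq with h | rfl
    · rw [strongDerivIter_add_one]
      exact fun s hs => ih (Order.lt_add_one_iff.1 h) hs.1.1
    · exact subset_rfl
  | limit ξ hξ ih =>
    rcases h.lt_or_eq with h | rfl
    · exact fun s hs => (mem_strongDerivIter_limit hξ).1 hs β h
    · exact subset_rfl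

theorem strongDerivIter_subset (F : Set (Finset ℕ+)) (M : Set ℕ+) (ξ : Ordinal.{0}) :
    strongDerivIter F M ξ ⊆ F ∩ finSubsets M := by
  rw [← strongDerivIter_zero]
  exact strongDerivIter_antitone F M zero_le

theorem isHereditary_strongDerivIter (hF : IsHereditary F) (hM : M.Infinite) (ξ : Ordinal.{0}) :
    IsHereditary (strongDerivIter F M ξ) := by
  induction ξ using Ordinal.limitRecOn with
  | zero =>
    rw [strongDerivIter_zero]
    exact hF.inter (isHereditary_finSubsets M)
  | add_one ξ ih =>
    rw [strongDerivIter_add_one]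
    exact isHereditary_strongDeriv ih hM
  | limit ξ hξ ih =>
    refine isHereditary_iff.2 fun s hs t hts => ?_
    rw [mem_strongDerivIter_limit hξ] at hs ⊢
    exact fun β hβ => (ih β hβ).mem (hs β hβ) hts

theorem mem_strongDerivIter_add_one (hF : IsHereditary F) (hM : M.Infinite) {ξ : Ordinal.{0}} :
    s ∈ strongDerivIter F M (ξ + 1) ↔
      s ∈ finSubsets M ∧ {n ∈ M | insert n s ∉ strongDerivIter F M ξ}.Finite := by
  rw [strongDerivIter_add_one, mem_strongDeriv_iff (isHereditary_strongDerivIter hF hM ξ) hM]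

/-- Membership in a derivative of any order, in terms of the smaller orders. -/
theorem mem_strongDerivIter_of_forall_lt {ξ : Ordinal.{0}} (h0 : s ∈ F ∩ finSubsets M)
    (h : ∀ β < ξ, s ∈ strongDerivIter F M (β + 1)) : s ∈ strongDerivIter F M ξ := by
  rcases Ordinal.zero_or_succ_or_isSuccLimit ξ with rfl | ⟨ζ, rfl⟩ | hξ
  · rwa [strongDerivIter_zero]
  · exact h ζ (Order.lt_succ ζ)
  · exact (mem_strongDerivIter_limit hξ).2 fun β hβ =>
      strongDerivIter_antitone F M (Order.le_succ β) (h β hβ)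

theorem exists_insert_mem_strongDerivIter (hF : IsHereditary F) (hM : M.Infinite)
    {ξ : Ordinal.{0}} (hs : s ∈ strongDerivIter F M (ξ + 1)) (m : ℕ+) :
    ∃ n ∈ M, m < n ∧ insert n s ∈ strongDerivIter F M ξ := by
  rw [mem_strongDerivIter_add_one hF hM] at hs
  obtain ⟨n, hn, hmn⟩ := exists_mem_gt (hM.sdiff hs.2) m
  refine ⟨n, hn.1, hmn, ?_⟩
  by_contra h
  exact hn.2 ⟨hn.1, h⟩

theorem mem_strongDerivIter_of_subset (hF : IsHereditary F) (hM : M.Infinite) (hL : L.Infinite)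
    (hLM : L ⊆ M) (ξ : Ordinal.{0}) (hs : s ∈ strongDerivIter F M ξ) (hsL : s ∈ finSubsets L) :
    s ∈ strongDerivIter F L ξ := by
  induction ξ using Ordinal.limitRecOn generalizing s with
  | zero =>
    rw [strongDerivIter_zero] at hs ⊢
    exact ⟨hs.1, hsL⟩
  | add_one ξ ih =>
    rw [mem_strongDerivIter_add_one hF hM] at hs
    rw [mem_strongDerivIter_add_one hF hL]
    exact ⟨hsL, hs.2.subset fun n hn => ⟨hLM hn.1, fun h =>
      hn.2 (ih h (insert_mem_finSubsets hn.1 hsL))⟩⟩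
  | limit ξ hξ ih =>
    rw [mem_strongDerivIter_limit hξ] at hs ⊢
    exact fun β hβ => ih β hβ (hs β hβ) hsL

theorem empty_mem_strongDerivIter (hF : IsHereditary F) (hM : M.Infinite) {ξ : Ordinal.{0}}
    (h : strongDerivIter F M ξ ≠ ∅) : ∅ ∈ strongDerivIter F M ξ := by
  obtain ⟨s, hs⟩ := Set.nonempty_iff_ne_empty.2 h
  exact (isHereditary_strongDerivIter hF hM ξ).mem hs (Finset.empty_subset s)

theorem strongDerivIter_ne_empty_of_lt {ξ : Ordinal.{0}} (h1 : 1 ≤ ξ)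
    (h : ξ < strongIndex F M) : strongDerivIter F M ξ ≠ ∅ := by
  intro h0
  exact h.not_ge (csInf_le' ⟨h1, h0⟩)

/-- Some derivative must be known to vanish, since otherwise `strongIndex` is `sInf ∅ = 0`. -/
theorem lt_strongIndex {ξ η : Ordinal.{0}} (h0 : strongDerivIter F M η = ∅)
    (h : strongDerivIter F M ξ ≠ ∅) : ξ < strongIndex F M := by
  have hne : {ξ : Ordinal.{0} | 1 ≤ ξ ∧ strongDerivIter F M ξ = ∅}.Nonempty := by
    refine ⟨η + 1, le_add_self, ?_⟩
    rw [← Set.subset_empty_iff, ← h0]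
    exact strongDerivIter_antitone F M (Order.le_succ η)
  by_contra! hle
  apply h
  rw [← Set.subset_empty_iff, ← (csInf_mem hne).2]
  exact strongDerivIter_antitone F M hle

theorem strongIndex_le {ξ : Ordinal.{0}} (h1 : 1 ≤ ξ) (h : strongDerivIter F M ξ = ∅) :
    strongIndex F M ≤ ξ :=
  csInf_le' ⟨h1, h⟩

theorem strongIndex_le_supIndex (hL : L ∈ infSubsets M) : strongIndex F L ≤ supIndex F M :=
  le_ciSup (f := fun L : infSubsets M => strongIndex F (L : Set ℕ+))
    (Ordinal.bddAbove_of_small) ⟨L, hL⟩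

end Hereditary

/-! ### Unions of consecutive blocks -/

section Blocks

variable {F G : Set (Finset ℕ+)} {Gs Hs : List (Set (Finset ℕ+))} {s : Finset ℕ+} {n : ℕ+}

theorem mem_blockUnions_cons : s ∈ blockUnions (G :: Gs) ↔
    ∃ t ∈ G, ∃ u ∈ blockUnions Gs, (∀ x ∈ t, ∀ y ∈ u, x < y) ∧ s = t ∪ u := Iff.rfl

theorem mem_blockUnions_append : s ∈ blockUnions (Gs ++ Hs) ↔
    ∃ t ∈ blockUnions Gs, ∃ u ∈ blockUnions Hs, (∀ x ∈ t, ∀ y ∈ u, x < y) ∧ s = t ∪ u := by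
  induction Gs generalizing s with
  | nil => simp [blockUnions]
  | cons G Gs ih =>
    simp only [List.cons_append, mem_blockUnions_cons]
    constructor
    · rintro ⟨t, ht, u, hu, htu, rfl⟩
      obtain ⟨v, hv, w, hw, hvw, rfl⟩ := ih.1 hu
      refine ⟨t ∪ v, ⟨t, ht, v, hv, fun x hx y hy => htu x hx y (Finset.mem_union_left _ hy), rfl⟩,
        w, hw, fun x hx y hy => ?_, (Finset.union_assoc _ _ _).symm⟩
      rcases Finset.mem_union.1 hx with hx | hx
      exacts [htu x hx y (Finset.mem_union_right _ hy), hvw x hx y hy]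
    · rintro ⟨_, ⟨t, ht, v, hv, htv, rfl⟩, w, hw, hvw, rfl⟩
      refine ⟨t, ht, v ∪ w, ih.2 ⟨v, hv, w, hw,
        fun x hx y hy => hvw x (Finset.mem_union_right _ hx) y hy, rfl⟩, fun x hx y hy => ?_,
        Finset.union_assoc _ _ _⟩
      rcases Finset.mem_union.1 hy with hy | hy
      exacts [htv x hx y hy, hvw x (Finset.mem_union_left _ hx) y hy]

theorem blockUnions_singleton (G : Set (Finset ℕ+)) : blockUnions [G] = G := by
  ext s
  simp [blockUnions]

/-- Blocks from `G` are nonempty, so the least element `n` lies in the first block; removing it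
affects that block only. -/
theorem insert_mem_blockUnions_cons (hG : ∅ ∉ G)
    (h : ∀ s : Finset ℕ+, (∀ x ∈ s, n < x) → (insert n s ∈ G ↔ s ∈ blockUnions Hs))
    (hs : ∀ x ∈ s, n < x) : insert n s ∈ blockUnions (G :: Gs) ↔ s ∈ blockUnions (Hs ++ Gs) := by
  have hns : n ∉ s := fun h => (hs n h).false
  rw [mem_blockUnions_append, mem_blockUnions_cons]
  constructor
  · rintro ⟨t, ht, u, hu, htu, hsu⟩
    obtain ⟨a, ha⟩ : t.Nonempty := Finset.nonempty_iff_ne_empty.2 fun h => hG (h ▸ ht)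
    have hle : ∀ x ∈ t ∪ u, n ≤ x := by
      rw [← hsu]
      intro x hx
      rcases Finset.mem_insert.1 hx with rfl | hx
      exacts [le_rfl, (hs x hx).le]
    have hnu : n ∉ u := fun hn =>
      ((htu a ha n hn).trans_le (hle a (Finset.mem_union_left _ ha))).false
    have hnt : n ∈ t := by
      have : n ∈ t ∪ u := hsu ▸ Finset.mem_insert_self n s
      exact (Finset.mem_union.1 this).resolve_right hnu
    refine ⟨t.erase n, (h _ fun x hx => ?_).1 (by rwa [Finset.insert_erase hnt]), u, hu,
      fun x hx y hy => htu x (Finset.mem_of_mem_erase hx) y hy, ?_⟩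
    · exact (hle x (Finset.mem_union_left _ (Finset.mem_of_mem_erase hx))).lt_of_ne
        (Finset.ne_of_mem_erase hx).symm
    · rw [← Finset.erase_insert hns, hsu, Finset.erase_union_distrib, Finset.erase_eq_of_notMem hnu]
  · rintro ⟨t, ht, u, hu, htu, rfl⟩
    refine ⟨insert n t, (h t fun x hx => hs x (Finset.mem_union_left _ hx)).2 ht, u, hu,
      fun x hx y hy => ?_, (Finset.insert_union _ _ _).symm⟩
    rcases Finset.mem_insert.1 hx with rfl | hx
    exacts [hs y (Finset.mem_union_right _ hy), htu x hx y hy]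

end Blocks

/-! ### Cantor normal forms as lists of exponents -/

section CantorNormalForm

open Ordinal

/-- The ordinal `ω^{aₖ} + ⋯ + ω^{a₁}` for the list `[a₁, …, aₖ]`. -/
noncomputable def cnfSum (d : List Ordinal.{0}) : Ordinal.{0} :=
  (d.reverse.map (fun a => ω ^ a)).sum

theorem cnfSum_append (d d' : List Ordinal.{0}) : cnfSum (d ++ d') = cnfSum d' + cnfSum d := by
  simp [cnfSum]

theorem cnfSum_cons (a : Ordinal.{0}) (d : List Ordinal.{0}) :
    cnfSum (a :: d) = cnfSum d + ω ^ a := by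
  simp [cnfSum]

theorem cnfSum_nil : cnfSum [] = 0 := by simp [cnfSum]

theorem sum_opow_lt {e : List Ordinal.{0}} {b : Ordinal.{0}} (h : ∀ a ∈ e, a < b) :
    (e.map (fun a => ω ^ a)).sum < ω ^ b := by
  induction e with
  | nil => simpa using opow_pos b omega0_pos
  | cons a e ih =>
    rw [List.map_cons, List.sum_cons]
    refine isPrincipal_add_omega0_opow b ?_ (ih fun x hx => h x (List.mem_cons_of_mem _ hx))
    exact (opow_lt_opow_iff_right one_lt_omega0).2 (h a List.mem_cons_self)

/-- A strictly larger leading exponent dominates the whole other sum, because powers of `ω` are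
additively principal; equal leading terms cancel on the left. -/
theorem sum_opow_injective {e e' : List Ordinal.{0}} (he : e.Pairwise (fun a b => b ≤ a))
    (he' : e'.Pairwise (fun a b => b ≤ a))
    (h : (e.map (fun a => ω ^ a)).sum = (e'.map (fun a => ω ^ a)).sum) : e = e' := by
  have aux : ∀ {a b : Ordinal.{0}} {d d' : List Ordinal.{0}},
      (a :: d).Pairwise (fun a b => b ≤ a) → a < b →
      ((a :: d).map (fun a => ω ^ a)).sum < ((b :: d').map (fun a => ω ^ a)).sum := by
    intro a b d d' hd hab
    refine (sum_opow_lt (b := b) fun x hx => ?_).trans_le ?_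
    · rcases List.mem_cons.1 hx with rfl | hx
      exacts [hab, ((List.pairwise_cons.1 hd).1 x hx).trans_lt hab]
    · rw [List.map_cons, List.sum_cons]
      exact le_self_add
  induction e generalizing e' with
  | nil =>
    cases e' with
    | nil => rfl
    | cons b e' =>
      rw [List.map_cons, List.sum_cons, List.map_nil, List.sum_nil] at h
      exact absurd (le_self_add.trans h.ge) (opow_pos b omega0_pos).not_ge
  | cons a e ih =>
    cases e' with
    | nil =>
      rw [List.map_cons, List.sum_cons, List.map_nil, List.sum_nil] at h
      exact absurd (le_self_add.trans h.le) (opow_pos a omega0_pos).not_ge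
    | cons b e' =>
      rcases lt_trichotomy a b with hab | rfl | hab
      · exact absurd h (aux he hab).ne
      · rw [List.map_cons, List.sum_cons, List.map_cons, List.sum_cons, add_right_inj] at h
        rw [ih (List.pairwise_cons.1 he).2 (List.pairwise_cons.1 he').2 h]
      · exact absurd h (aux he' hab).ne'

theorem exists_sum_opow (ξ : Ordinal.{0}) : ∃ e : List Ordinal.{0},
    e.Pairwise (fun a b => b ≤ a) ∧ (e.map (fun a => ω ^ a)).sum = ξ := by
  induction ξ using WellFoundedLT.induction with
  | ind ξ ih =>
    rcases eq_or_ne ξ 0 with rfl | h0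
    · exact ⟨[], List.Pairwise.nil, rfl⟩
    have hle : ω ^ log ω ξ ≤ ξ := opow_log_le_self ω h0
    have hadd : ω ^ log ω ξ + (ξ - ω ^ log ω ξ) = ξ := Ordinal.add_sub_cancel_of_le hle
    -- If subtracting the leading power changed nothing, `ξ` would absorb it on the left and so be
    -- at least `ω ^ (log ω ξ + 1)`.
    have hlt : ξ - ω ^ log ω ξ < ξ := by
      refine (Ordinal.sub_le_self _ _).lt_of_ne fun h => ?_
      rw [h, add_eq_right_iff_mul_omega0_le, ← opow_succ] at hadd
      exact (lt_opow_succ_log_self one_lt_omega0 ξ).not_ge hadd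
    obtain ⟨e, he, hsum⟩ := ih _ hlt
    refine ⟨log ω ξ :: e, List.pairwise_cons.2 ⟨fun a ha => ?_, he⟩, ?_⟩
    · refine (opow_le_iff_le_log one_lt_omega0 h0).1 (le_trans ?_ hlt.le)
      rw [← hsum]
      exact List.le_sum_of_mem (List.mem_map_of_mem ha)
    · rw [List.map_cons, List.sum_cons, hsum, hadd]

theorem exists_cnfSum (ξ : Ordinal.{0}) :
    ∃ d : List Ordinal.{0}, d.Pairwise (· ≤ ·) ∧ cnfSum d = ξ := by
  obtain ⟨e, he, h⟩ := exists_sum_opow ξ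
  exact ⟨e.reverse, List.pairwise_reverse.2 he, by rw [cnfSum, List.reverse_reverse, h]⟩

end CantorNormalForm

/-! ### Sections of the Schreier families -/

section Schreier

open Ordinal

variable (c : LadderSystem)

theorem mem_powerFamily_zero {s : Finset ℕ+} : s ∈ powerFamily c 0 ↔ ∃ n : ℕ+, s = {n} := by
  rw [powerFamily, limitRecOn_zero]
  rfl

theorem mem_powerFamily_add_one {s : Finset ℕ+} {β : Ordinal.{0}} : s ∈ powerFamily c (β + 1) ↔
    ∃ h : s.Nonempty, s ∈ blockUnions (List.replicate (s.min' h : ℕ) (powerFamily c β)) := by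
  rw [powerFamily, limitRecOn_add_one]
  rfl

theorem mem_powerFamily_limit {s : Finset ℕ+} {δ : Ordinal.{0}} (hδ : Order.IsSuccLimit δ) :
    s ∈ powerFamily c δ ↔ ∃ (h : s.Nonempty) (_ : c.seq δ (s.min' h) < δ),
      s ∈ powerFamily c (c.seq δ (s.min' h)) := by
  rw [powerFamily, limitRecOn_limit _ _ _ _ hδ]
  rfl

theorem empty_notMem_powerFamily (α : Ordinal.{0}) : ∅ ∉ powerFamily c α := by
  rcases zero_or_succ_or_isSuccLimit α with rfl | ⟨β, rfl⟩ | hα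
  · rw [mem_powerFamily_zero]
    rintro ⟨n, hn⟩
    exact Finset.singleton_ne_empty n hn.symm
  · rw [Order.succ_eq_add_one, mem_powerFamily_add_one]
    rintro ⟨h, -⟩
    exact Finset.not_nonempty_empty h
  · rw [mem_powerFamily_limit c hα]
    rintro ⟨h, -⟩
    exact Finset.not_nonempty_empty h

theorem schreier_zero : schreier c 0 = {∅} := by
  rw [schreier, limitRecOn_zero]

theorem mem_schreier_add_one {s : Finset ℕ+} {ζ : Ordinal.{0}} : s ∈ schreier c (ζ + 1) ↔
    ∃ n : ℕ+, ∃ t ∈ schreier c ζ, (∀ x ∈ t, n < x) ∧ s = insert n t := by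
  rw [schreier, limitRecOn_add_one]
  rfl

theorem mem_schreier_limit {s : Finset ℕ+} {η : Ordinal.{0}} (hη : Order.IsSuccLimit η) :
    s ∈ schreier c η ↔ ∃ e : List Ordinal.{0}, e.Pairwise (fun a b => b ≤ a) ∧
      (∀ a ∈ e, 0 < a) ∧ η = (e.map (fun a => omega0 ^ a)).sum ∧
      s ∈ blockUnions (e.reverse.map (powerFamily c)) := by
  rw [schreier, limitRecOn_limit _ _ _ _ hη]
  rfl

/-- Uniform description of the Schreier families, at zero, successor and limit ordinals. -/
theorem schreier_cnfSum {d : List Ordinal.{0}} (hd : d.Pairwise (· ≤ ·)) :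
    schreier c (cnfSum d) = blockUnions (d.map (powerFamily c)) := by
  induction d with
  | nil => simp [cnfSum_nil, schreier_zero, blockUnions]
  | cons a d ih =>
    rcases eq_or_ne a 0 with rfl | ha
    · ext s
      rw [cnfSum_cons, opow_zero, mem_schreier_add_one, ih (List.pairwise_cons.1 hd).2,
        List.map_cons, mem_blockUnions_cons]
      constructor
      · rintro ⟨n, t, ht, hnt, rfl⟩
        exact ⟨{n}, (mem_powerFamily_zero c).2 ⟨n, rfl⟩, t, ht, by simpa using hnt, rfl⟩
      · rintro ⟨v, hv, t, ht, hvt, rfl⟩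
        obtain ⟨n, rfl⟩ := (mem_powerFamily_zero c).1 hv
        exact ⟨n, t, ht, by simpa using hvt, rfl⟩
    -- The head `a` is the smallest exponent and the last summand, so `a ≠ 0` puts the ordinal in
    -- the limit clause, where uniqueness of the normal form identifies the list.
    · have hlim : Order.IsSuccLimit (cnfSum (a :: d)) := by
        rw [cnfSum_cons]
        exact isSuccLimit_add _ (isSuccLimit_opow_left isSuccLimit_omega0 ha)
      ext s
      rw [mem_schreier_limit c hlim]
      constructor
      · rintro ⟨e, he, -, hsum, hs⟩
        have : (a :: d).reverse = e :=
          sum_opow_injective (List.pairwise_reverse.2 hd) he hsum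
        rwa [← this, List.reverse_reverse] at hs
      · intro hs
        refine ⟨(a :: d).reverse, List.pairwise_reverse.2 hd, fun b hb => ?_, rfl, ?_⟩
        · have ha' := pos_iff_ne_zero.2 ha
          rcases List.mem_cons.1 (List.mem_reverse.1 hb) with rfl | hb
          exacts [ha', ha'.trans_le ((List.pairwise_cons.1 hd).1 b hb)]
        · rwa [List.reverse_reverse]

theorem min'_insert_of_forall_lt {n : ℕ+} {s : Finset ℕ+} (hs : ∀ x ∈ s, n < x)
    (h : (insert n s).Nonempty) : (insert n s).min' h = n := by
  refine le_antisymm (Finset.min'_le _ _ (Finset.mem_insert_self n s)) ?_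
  refine Finset.le_min' _ _ _ fun x hx => ?_
  rcases Finset.mem_insert.1 hx with rfl | hx
  exacts [le_rfl, (hs x hx).le]

theorem cnfSum_replicate (β : Ordinal.{0}) (k : ℕ) :
    cnfSum (List.replicate k β) = ω ^ β * k := by
  induction k with
  | zero => simp [cnfSum_nil]
  | succ k ih => rw [List.replicate_succ, cnfSum_cons, ih, Nat.cast_succ, mul_add_one]

/-- The sections of the families `powerFamily c α` at a point, as block unions. -/
theorem exists_section_powerFamily (α : Ordinal.{0}) (hα : α < Ordinal.omega 1) :
    ∃ g : ℕ+ → List Ordinal.{0}, (∀ n, (g n).Pairwise (· ≤ ·)) ∧ (∀ n, ∀ b ∈ g n, b < α) ∧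
      (∀ n s, (∀ x ∈ s, n < x) →
        (insert n s ∈ powerFamily c α ↔ s ∈ blockUnions ((g n).map (powerFamily c)))) ∧
      (∀ ν, α = ν + 1 → ∀ n, 1 < n → ω ^ ν ≤ cnfSum (g n)) ∧
      ∀ β < ω ^ α, ∃ N, ∀ n ≥ N, β ≤ cnfSum (g n) := by
  induction α using Ordinal.limitRecOn with
  | zero =>
    refine ⟨fun _ => [], fun _ => List.Pairwise.nil, by simp, fun n s hs => ?_,
      fun ν h => absurd h.symm (by simp), fun β hβ => ⟨1, fun n _ => ?_⟩⟩
    · rw [mem_powerFamily_zero, List.map_nil]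
      constructor
      · rintro ⟨m, hm⟩
        have hnm : n = m := Finset.mem_singleton.1 (hm ▸ Finset.mem_insert_self n s)
        refine Finset.eq_empty_of_forall_notMem fun x hx => ?_
        have hxm : x = m := Finset.mem_singleton.1 (hm ▸ Finset.mem_insert_of_mem hx)
        exact (hs x hx).ne (hnm.trans hxm.symm)
      · intro h
        exact ⟨n, by rw [show s = ∅ from h]; rfl⟩
    · rw [opow_zero, Order.lt_one_iff] at hβ
      simp [hβ]
  | add_one α ih =>
    obtain ⟨g, hg1, hg2, hg3, -, -⟩ := ih ((Order.lt_succ α).trans hα)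
    have hle : ∀ n : ℕ+, ω ^ α * ((n - 1 : ℕ) : Ordinal.{0}) ≤
        cnfSum (g n ++ List.replicate (n - 1 : ℕ) α) := fun n => by
      rw [cnfSum_append, cnfSum_replicate]
      exact le_self_add
    -- Of the `n` blocks of order `α`, the first loses its minimum `n` and becomes `g n`; the other
    -- `n - 1` remain.
    refine ⟨fun n => g n ++ List.replicate (n - 1 : ℕ) α, fun n => ?_, fun n b hb => ?_,
      fun n s hs => ?_, fun ν h n hn => ?_, fun β hβ => ?_⟩
    · refine List.pairwise_append.2 ⟨hg1 n, List.pairwise_replicate.2 (Or.inr le_rfl), ?_⟩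
      intro a ha b hb
      rw [List.eq_of_mem_replicate hb]
      exact (hg2 n a ha).le
    · rcases List.mem_append.1 hb with hb | hb
      · exact (hg2 n b hb).trans (Order.lt_succ α)
      · rw [List.eq_of_mem_replicate hb]
        exact Order.lt_succ α
    · rw [mem_powerFamily_add_one, List.map_append, List.map_replicate,
        ← insert_mem_blockUnions_cons (empty_notMem_powerFamily c α) (hg3 n) hs,
        ← List.replicate_succ, Nat.sub_add_cancel n.pos]
      constructor
      · rintro ⟨h, h'⟩
        rwa [min'_insert_of_forall_lt hs] at h'
      · intro h
        refine ⟨Finset.insert_nonempty n s, ?_⟩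
        rwa [min'_insert_of_forall_lt hs]
    · obtain rfl : α = ν := by simpa using h
      refine le_trans ?_ (hle n)
      have : (1 : Ordinal.{0}) ≤ ((n - 1 : ℕ) : Ordinal.{0}) := by
        have h1 : 1 < (n : ℕ) := hn
        exact_mod_cast (by omega : 1 ≤ (n : ℕ) - 1)
      simpa using mul_le_mul_right this (ω ^ α)
    · rw [← Order.succ_eq_add_one, opow_succ, lt_mul_iff_of_isSuccLimit isSuccLimit_omega0] at hβ
      obtain ⟨_, hk, hβ⟩ := hβ
      obtain ⟨k, rfl⟩ := lt_omega0.1 hk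
      refine ⟨⟨k + 1, k.succ_pos⟩, fun n hn => hβ.le.trans (le_trans ?_ (hle n))⟩
      have hn' : k + 1 ≤ (n : ℕ) := hn
      have : (k : Ordinal.{0}) ≤ ((n - 1 : ℕ) : Ordinal.{0}) := by
        exact_mod_cast (by omega : k ≤ (n : ℕ) - 1)
      exact mul_le_mul_right this (ω ^ α)
  | limit δ hδ ih =>
    choose G hG1 hG2 hG3 hG4 hG5 using fun b (hb : b < δ) => ih b hb (hb.trans hα)
    have hlt := c.lt δ hδ hα
    refine ⟨fun n => G _ (hlt n) n, fun n => hG1 _ _ n,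
      fun n b hb => (hG2 _ _ n b hb).trans (hlt n), fun n s hs => ?_, fun ν h => ?_,
      fun β hβ => ?_⟩
    · rw [← hG3 _ _ n s hs, mem_powerFamily_limit c hδ]
      have := min'_insert_of_forall_lt hs (Finset.insert_nonempty n s)
      constructor
      · rintro ⟨_, _, h⟩
        rwa [this] at h
      · intro h
        exact ⟨Finset.insert_nonempty n s, by rw [this]; exact hlt n, by rwa [this]⟩
    · exact absurd (h ▸ hδ) (Order.not_isSuccLimit_add_one ν)
    -- The order `c.seq δ n` varies with `n`, so the eventual bounds of the induction hypothesis are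
    -- not uniform enough. The clause for successor exponents holds for every `n > 1`; it applies
    -- because ladder terms are successors.
    · obtain ⟨μ, hμ, hβ⟩ := (lt_opow_of_isSuccLimit omega0_ne_zero hδ).1 hβ
      obtain ⟨_, ⟨N, rfl⟩, hN⟩ := (lt_isLUB_iff (c.isLUB δ hδ hα)).1 hμ
      -- The shift by one secures `n > 1`.
      refine ⟨N + 1, fun n hn => ?_⟩
      obtain ⟨ν, hν⟩ := c.isSucc δ hδ hα n
      have hμν : μ ≤ ν := by
        rw [← Order.lt_add_one_iff, ← hν]
        exact hN.trans_le ((c.strictMono δ hδ hα).monotone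
          ((PNat.lt_add_right N 1).le.trans hn))
      refine hβ.le.trans (le_trans (opow_le_opow_right omega0_pos hμν) ?_)
      refine hG4 _ (hlt n) ν hν n (lt_of_lt_of_le ?_ hn)
      exact PNat.lt_add_left 1 N

theorem empty_notMem_schreier {ξ : Ordinal.{0}} (hξ : ξ ≠ 0) : ∅ ∉ schreier c ξ := by
  obtain ⟨d, hd, rfl⟩ := exists_cnfSum ξ
  cases d with
  | nil => exact absurd cnfSum_nil hξ
  | cons a d =>
    rw [schreier_cnfSum c hd, List.map_cons, mem_blockUnions_cons]
    rintro ⟨t, ht, u, -, -, h⟩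
    have : t = ∅ := (Finset.union_eq_empty.1 h.symm).1
    exact empty_notMem_powerFamily c a (this ▸ ht)

/-- The sections of the family of order `ξ` at the points `n` are families of smaller orders,
cofinal in `ξ`. -/
theorem exists_section_schreier {ξ : Ordinal.{0}} (hξ : ξ < Ordinal.omega 1) (h0 : ξ ≠ 0) :
    ∃ f : ℕ+ → Ordinal.{0}, (∀ n, f n < ξ) ∧
      (∀ n s, (∀ x ∈ s, n < x) → (insert n s ∈ schreier c ξ ↔ s ∈ schreier c (f n))) ∧
      ∀ β < ξ, ∃ N, ∀ n ≥ N, β ≤ f n := by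
  obtain ⟨d, hd, rfl⟩ := exists_cnfSum ξ
  cases d with
  | nil => exact absurd cnfSum_nil h0
  | cons a d =>
    rw [cnfSum_cons] at hξ
    have ha : a < Ordinal.omega 1 :=
      (right_le_opow a one_lt_omega0).trans_lt (le_add_self.trans_lt hξ)
    obtain ⟨hda, hd'⟩ := List.pairwise_cons.1 hd
    obtain ⟨g, hg1, hg2, hg3, -, hg5⟩ := exists_section_powerFamily c a ha
    -- Only the last summand `ω ^ a`, which governs the first block, is replaced.
    refine ⟨fun n => cnfSum (g n ++ d), fun n => ?_, fun n s hs => ?_, fun β hβ => ?_⟩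
    · beta_reduce
      rw [cnfSum_append, cnfSum_cons]
      exact add_lt_add_right (sum_opow_lt fun b hb => hg2 n b (List.mem_reverse.1 hb)) _
    · have hp : (g n ++ d).Pairwise (· ≤ ·) := List.pairwise_append.2
        ⟨hg1 n, hd', fun x hx y hy => (hg2 n x hx).le.trans (hda y hy)⟩
      rw [schreier_cnfSum c hd, schreier_cnfSum c hp, List.map_cons, List.map_append]
      exact insert_mem_blockUnions_cons (empty_notMem_powerFamily c a) (hg3 n) hs
    · rw [cnfSum_cons, lt_add_iff (opow_pos a omega0_pos).ne'] at hβ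
      obtain ⟨γ, hγ, hβ⟩ := hβ
      obtain ⟨N, hN⟩ := hg5 γ hγ
      refine ⟨N, fun n hn => hβ.trans ?_⟩
      beta_reduce
      rw [cnfSum_append]
      exact add_le_add_right (hN n hn) _

end Schreier

/-! ### Ramsey dichotomy and comparability -/

section Ramsey

/-- Diagonalization: if every infinite set has an infinite subset that is good for `n`, then it has
an infinite subset whose tails are good for all of its elements. -/
theorem exists_diagonal {P : ℕ+ → Set ℕ+ → Prop}
    (hP : ∀ n (M : Set ℕ+), M.Infinite → ∃ L ∈ infSubsets M, P n L)
    (hmono : ∀ n L L', L' ⊆ L → P n L → P n L') {M : Set ℕ+} (hM : M.Infinite) :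
    ∃ L ∈ infSubsets M, ∀ n ∈ L, P n (L ∩ Ioi n) := by
  choose g hg hPg using hP
  let pick : {M : Set ℕ+ // M.Infinite} → ℕ+ := fun X => X.2.nonempty.choose
  have hpick : ∀ X, pick X ∈ X.1 := fun X => X.2.nonempty.choose_spec
  -- Fusion: pick a point, thin the rest of the set to one good for that point, and repeat; the
  -- picked points form `L`.
  let next : {M : Set ℕ+ // M.Infinite} → {M : Set ℕ+ // M.Infinite} := fun X =>
    ⟨g (pick X) _ (infinite_inter_Ioi X.2 (pick X)), (hg _ _ _).2⟩
  have hnext : ∀ X, (next X).1 ⊆ X.1 ∩ Ioi (pick X) := fun X => (hg _ _ _).1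
  let S : ℕ → {M : Set ℕ+ // M.Infinite} := fun k => next^[k] ⟨M, hM⟩
  have hS : ∀ k, S (k + 1) = next (S k) := fun k => Function.iterate_succ_apply' _ _ _
  have hanti : Antitone fun k => (S k).1 := antitone_nat_of_succ_le fun k => by
    rw [hS]
    exact (hnext _).trans inter_subset_left
  have hmem : ∀ j k, j < k → pick (S k) ∈ (S (j + 1)).1 := fun j k hjk => hanti hjk (hpick _)
  have hx : StrictMono fun k => pick (S k) := strictMono_nat_of_lt_succ fun k => by
    have := hmem k (k + 1) k.lt_succ_self
    rw [hS] at this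
    show pick (S k) < pick (S (k + 1))
    rw [hS]
    exact (hnext _ this).2
  refine ⟨range fun k => pick (S k), ⟨?_, infinite_range_of_injective hx.injective⟩, ?_⟩
  · rintro _ ⟨k, rfl⟩
    exact hanti (Nat.zero_le k) (hpick _)
  · rintro _ ⟨j, rfl⟩
    refine hmono _ _ _ ?_ (hPg (pick (S j)) _ (infinite_inter_Ioi (S j).2 (pick (S j))))
    rintro _ ⟨⟨k, rfl⟩, hk⟩
    have := hmem j k (hx.lt_iff_lt.1 hk)
    rw [hS] at this
    exact this

variable (c : LadderSystem)

theorem eq_insert_of_mem_schreier {ξ : Ordinal.{0}} (h0 : ξ ≠ 0) {s : Finset ℕ+}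
    (hs : s ∈ schreier c ξ) : ∃ n t, (∀ x ∈ t, n < x) ∧ s = insert n t := by
  have hne : s.Nonempty :=
    Finset.nonempty_iff_ne_empty.2 fun h => empty_notMem_schreier c h0 (h ▸ hs)
  refine ⟨s.min' hne, s.erase (s.min' hne), fun x hx => ?_,
    (Finset.insert_erase (s.min'_mem hne)).symm⟩
  exact Finset.min'_lt_of_mem_erase_min' s hne hx

/-- The Ramsey theorem for the Schreier families. -/
theorem exists_homogeneous (ξ : Ordinal.{0}) (hξ : ξ < Ordinal.omega 1) (F : Set (Finset ℕ+))
    (M : Set ℕ+) (hM : M.Infinite) : ∃ L ∈ infSubsets M,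
      schreier c ξ ∩ finSubsets L ⊆ F ∨ schreier c ξ ∩ finSubsets L ⊆ Fᶜ := by
  induction ξ using WellFoundedLT.induction generalizing F M with
  | ind ξ ih =>
    rcases eq_or_ne ξ 0 with rfl | h0
    · refine ⟨M, ⟨subset_rfl, hM⟩, ?_⟩
      rw [schreier_zero]
      by_cases h : ∅ ∈ F
      · left
        rintro s ⟨rfl, -⟩
        exact h
      · right
        rintro s ⟨rfl, -⟩
        exact h
    obtain ⟨f, hf, hsec, -⟩ := exists_section_schreier c hξ h0
    obtain ⟨L, hL, h⟩ := exists_diagonal (P := fun n L =>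
        schreier c (f n) ∩ finSubsets L ⊆ {s | insert n s ∈ F} ∨
        schreier c (f n) ∩ finSubsets L ⊆ {s | insert n s ∈ F}ᶜ)
      (fun n M hM => ih (f n) (hf n) ((hf n).trans hξ) _ M hM)
      (fun n L L' hL h => h.imp
        (fun h => (inter_subset_inter_right _ (finSubsets_mono hL)).trans h)
        (fun h => (inter_subset_inter_right _ (finSubsets_mono hL)).trans h)) hM
    have key : ∀ (K : Set ℕ+) (H : Set (Finset ℕ+)), K ⊆ L →
        (∀ n ∈ K, schreier c (f n) ∩ finSubsets (L ∩ Ioi n) ⊆ {s | insert n s ∈ H}) →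
        schreier c ξ ∩ finSubsets K ⊆ H := by
      rintro K H hK hKH s ⟨hs, hsK⟩
      obtain ⟨n, t, hnt, rfl⟩ := eq_insert_of_mem_schreier c h0 hs
      refine hKH n (hsK (Finset.mem_coe.2 (Finset.mem_insert_self n t)))
        ⟨(hsec n t hnt).1 hs, fun x hx => ⟨hK (hsK ?_), hnt x hx⟩⟩
      exact Finset.mem_coe.2 (Finset.mem_insert_of_mem hx)
    -- Each `n ∈ L` has a colour deciding every member of the family that starts at `n` and
    -- continues in `L`; one colour occurs infinitely often.
    have hunion : L ⊆ {n ∈ L | schreier c (f n) ∩ finSubsets (L ∩ Ioi n) ⊆ {s | insert n s ∈ F}} ∪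
        {n ∈ L | schreier c (f n) ∩ finSubsets (L ∩ Ioi n) ⊆ {s | insert n s ∈ F}ᶜ} :=
      fun n hn => (h n hn).imp (fun h => ⟨hn, h⟩) (fun h => ⟨hn, h⟩)
    rcases infinite_union.1 (hL.2.mono hunion) with hinf | hinf
    · exact ⟨_, ⟨(sep_subset _ _).trans hL.1, hinf⟩,
        Or.inl (key _ F (sep_subset _ _) fun n hn => hn.2)⟩
    · exact ⟨_, ⟨(sep_subset _ _).trans hL.1, hinf⟩,
        Or.inr (key _ Fᶜ (sep_subset _ _) fun n hn => hn.2)⟩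

theorem IsInitialSegment.insert {n : ℕ+} {t u : Finset ℕ+} (h : IsInitialSegment t u)
    (hu : ∀ y ∈ u, n < y) : IsInitialSegment (insert n t) (insert n u) := by
  refine ⟨Finset.insert_subset_insert n h.1, fun x hx y hy hyx => ?_⟩
  rcases Finset.mem_insert.1 hy with rfl | hyu
  · exact Finset.mem_insert_self _ _
  rcases Finset.mem_insert.1 hx with rfl | hxt
  · exact absurd hyx (hu y hyu).not_ge
  · exact Finset.mem_insert_of_mem (h.2 x hxt y hyu hyx)

/-- Every finite set is comparable, as an initial segment, to a member of `schreier c ξ`. -/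
theorem exists_comparable (ξ : Ordinal.{0}) (hξ : ξ < Ordinal.omega 1) (m : ℕ) (s : Finset ℕ+)
    (hs : ∀ x ∈ s, m < (x : ℕ)) : ∃ t ∈ schreier c ξ, (∀ x ∈ t, m < (x : ℕ)) ∧
      (IsInitialSegment t s ∨ IsInitialSegment s t) := by
  induction ξ using WellFoundedLT.induction generalizing m s with
  | ind ξ ih =>
    rcases eq_or_ne ξ 0 with rfl | h0
    · refine ⟨∅, by rw [schreier_zero]; rfl, by simp, Or.inl ⟨Finset.empty_subset s, by simp⟩⟩
    obtain ⟨f, hf, hsec, -⟩ := exists_section_schreier c hξ h0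
    rcases s.eq_empty_or_nonempty with rfl | hne
    -- For empty `s` any member above `m` will do; `m + 1` is an admissible first element.
    · let n : ℕ+ := ⟨m + 1, m.succ_pos⟩
      obtain ⟨t, ht, hnt, -⟩ := ih _ (hf n) ((hf _).trans hξ) n ∅ (by simp)
      refine ⟨insert n t, (hsec _ t hnt).2 ht, fun x hx => ?_,
        Or.inr ⟨Finset.empty_subset _, by simp⟩⟩
      have hm : m < (n : ℕ) := m.lt_succ_self
      rcases Finset.mem_insert.1 hx with rfl | hx
      exacts [hm, hm.trans (hnt x hx)]
    · set n := s.min' hne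
      have hns : n ∈ s := s.min'_mem hne
      have hlt : ∀ x ∈ s.erase n, n < x := fun x hx => Finset.min'_lt_of_mem_erase_min' s hne hx
      obtain ⟨t, ht, hnt, h⟩ := ih _ (hf n) ((hf n).trans hξ) n (s.erase n) hlt
      refine ⟨insert n t, (hsec n t hnt).2 ht, fun x hx => ?_, ?_⟩
      · rcases Finset.mem_insert.1 hx with rfl | hx
        exacts [hs _ hns, (hs n hns).trans (hnt x hx)]
      · rw [← Finset.insert_erase hns]
        exact h.imp (fun h => h.insert hlt) (fun h => h.insert hnt)

end Ramsey

/-! ### Schreier families and the order of vanishing -/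

section Index

variable (c : LadderSystem) {F : Set (Finset ℕ+)} {M : Set ℕ+} {t : Finset ℕ+}

theorem union_mem_of_insert {n : ℕ+} {s : Finset ℕ+} {H : Finset ℕ+ → Prop}
    (h : H (t ∪ insert n s)) : H (insert n t ∪ s) := by
  rwa [Finset.insert_union, ← Finset.union_insert]

/-- If `F` contains `schreier c ξ` beyond `t`, then `t` survives `ξ` derivations. -/
theorem mem_strongDerivIter_of_schreier_subset (hF : IsHereditary F) (hM : M.Infinite)
    (ξ : Ordinal.{0}) (hξ : ξ < Ordinal.omega 1) (ht : t ∈ finSubsets M)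
    (h : ∀ s ∈ schreier c ξ ∩ finSubsets M, (∀ x ∈ t, ∀ y ∈ s, x < y) → t ∪ s ∈ F) :
    t ∈ strongDerivIter F M ξ := by
  induction ξ using WellFoundedLT.induction generalizing t with
  | ind ξ ih =>
    rcases eq_or_ne ξ 0 with rfl | h0
    · rw [strongDerivIter_zero]
      refine ⟨?_, ht⟩
      simpa using h ∅ ⟨by rw [schreier_zero]; rfl, empty_mem_finSubsets M⟩ (by simp)
    obtain ⟨f, hf, hsec, hcof⟩ := exists_section_schreier c hξ h0
    have key : ∀ n ∈ M, (∀ x ∈ t, x < n) → insert n t ∈ strongDerivIter F M (f n) := by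
      intro n hn htn
      refine ih _ (hf n) ((hf n).trans hξ) (insert_mem_finSubsets hn ht) fun s hs hts => ?_
      have hns : ∀ x ∈ s, n < x := hts n (Finset.mem_insert_self n t)
      refine union_mem_of_insert (H := (· ∈ F)) (h _ ⟨(hsec n s hns).2 hs.1,
        insert_mem_finSubsets hn hs.2⟩ fun x hx y hy => ?_)
      rcases Finset.mem_insert.1 hy with rfl | hy
      exacts [htn x hx, (htn x hx).trans (hns y hy)]
    obtain ⟨m, hm⟩ := exists_forall_lt t
    refine mem_strongDerivIter_of_forall_lt ⟨?_, ht⟩ fun β hβ => ?_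
    · obtain ⟨n, hn, hmn⟩ := exists_mem_gt hM m
      have := key n hn fun x hx => (hm x hx).trans hmn
      exact hF.mem (strongDerivIter_subset F M _ this).1 (Finset.subset_insert n t)
    -- For large `n`, `insert n t` survives `f n ≥ β` derivations, so only finitely many `n` fail at
    -- order `β`.
    · obtain ⟨N, hN⟩ := hcof β hβ
      rw [mem_strongDerivIter_add_one hF hM]
      refine ⟨ht, (Set.finite_Iio (max m N)).subset fun n hn => ?_⟩
      by_contra hle
      obtain ⟨h1, h2⟩ := max_le_iff.1 (not_lt.1 fun h => hle (mem_Iio.2 h))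
      exact hn.2 (strongDerivIter_antitone F M (hN n h2)
        (key n hn.1 fun x hx => (hm x hx).trans_le h1))

/-- If `F` avoids `schreier c ξ` beyond `t`, then `t` does not survive `ξ + 1` derivations. -/
theorem notMem_strongDerivIter_of_schreier_subset_compl (hF : IsHereditary F) (hM : M.Infinite)
    (ξ : Ordinal.{0}) (hξ : ξ < Ordinal.omega 1)
    (h : ∀ s ∈ schreier c ξ ∩ finSubsets M, (∀ x ∈ t, ∀ y ∈ s, x < y) → t ∪ s ∉ F) :
    t ∉ strongDerivIter F M (ξ + 1) := by
  induction ξ using WellFoundedLT.induction generalizing t with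
  | ind ξ ih =>
    intro ht
    rcases eq_or_ne ξ 0 with rfl | h0
    · have := h ∅ ⟨by rw [schreier_zero]; rfl, empty_mem_finSubsets M⟩ (by simp)
      rw [Finset.union_empty] at this
      exact this (strongDerivIter_subset F M _ ht).1
    obtain ⟨f, hf, hsec, -⟩ := exists_section_schreier c hξ h0
    obtain ⟨m, hm⟩ := exists_forall_lt t
    obtain ⟨n, hn, hmn, hmem⟩ := exists_insert_mem_strongDerivIter hF hM ht m
    -- Survival of `insert n t` to order `ξ ≥ f n + 1` contradicts the induction hypothesis for the
    -- section at `n`.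
    refine ih _ (hf n) ((hf n).trans hξ) (t := insert n t) (fun s hs hts => ?_)
      (strongDerivIter_antitone F M (Order.add_one_le_iff.2 (hf n)) hmem)
    have hns : ∀ x ∈ s, n < x := hts n (Finset.mem_insert_self n t)
    refine union_mem_of_insert (H := (· ∉ F)) (h _ ⟨(hsec n s hns).2 hs.1,
      insert_mem_finSubsets hn hs.2⟩ fun x hx y hy => ?_)
    have htn := (hm x hx).trans hmn
    rcases Finset.mem_insert.1 hy with rfl | hy
    exacts [htn, htn.trans (hns y hy)]

theorem strongDerivIter_ne_empty_of_schreier_subset (hF : IsHereditary F) (hM : M.Infinite)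
    {ξ : Ordinal.{0}} (hξ : ξ < Ordinal.omega 1) (h : schreier c ξ ∩ finSubsets M ⊆ F) :
    strongDerivIter F M ξ ≠ ∅ :=
  Set.nonempty_iff_ne_empty.1 ⟨∅, mem_strongDerivIter_of_schreier_subset c hF hM ξ hξ
    (empty_mem_finSubsets M) fun s hs _ => by simpa using h hs⟩

theorem strongDerivIter_eq_empty_of_schreier_subset_compl (hF : IsHereditary F) (hM : M.Infinite)
    {ξ : Ordinal.{0}} (hξ : ξ < Ordinal.omega 1) (h : schreier c ξ ∩ finSubsets M ⊆ Fᶜ) :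
    strongDerivIter F M (ξ + 1) = ∅ := by
  by_contra hne
  exact notMem_strongDerivIter_of_schreier_subset_compl c hF hM ξ hξ
    (fun s hs _ => by simpa using h hs) (empty_mem_strongDerivIter hF hM hne)

/-- A member of `F` is comparable with some Schreier set; were the Schreier set the initial segment,
heredity would put it in `F`. -/
theorem schreier_subset_compl_iff (hF : IsHereditary F) {ξ : Ordinal.{0}}
    (hξ : ξ < Ordinal.omega 1) (L : Set ℕ+) : schreier c ξ ∩ finSubsets L ⊆ Fᶜ ↔
      F ∩ finSubsets L ⊆ initialSegments (schreier c ξ) \ schreier c ξ := by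
  constructor
  · rintro h s ⟨hsF, hsL⟩
    refine ⟨Or.inl ?_, fun hs => h ⟨hs, hsL⟩ hsF⟩
    obtain ⟨t, ht, -, hts | hst⟩ := exists_comparable c ξ hξ 0 s fun x _ => x.pos
    · exact absurd (hF.mem hsF hts.1) (h ⟨ht, fun x hx => hsL (hts.1 hx)⟩)
    · exact ⟨t, ht, hst⟩
  · rintro h s ⟨hs, hsL⟩ hsF
    exact (h ⟨hsF, hsL⟩).2 hs

end Index

/-! ### Closedness, well-foundedness and countable rank -/

section Closed

variable {F : Set (Finset ℕ+)} {M : Set ℕ+}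

/-- A hereditary family that is not pointwise closed on `M` contains all finite subsets of some
infinite subset of `M`. -/
theorem exists_finSubsets_subset (hF : IsHereditary F)
    (h : ¬ PointwiseClosed (F ∩ finSubsets M)) : ∃ L ∈ infSubsets M, finSubsets L ⊆ F := by
  rw [PointwiseClosed, ← closure_subset_iff_isClosed, Set.not_subset] at h
  obtain ⟨x, hx, hxF⟩ := h
  -- Members approximating the limit point `x` eventually contain any given finite part of it. The
  -- support of `x` is infinite, or `x` itself would belong to the family.
  have key : ∀ s : Finset ℕ+, (∀ i ∈ s, x i = true) → s ∈ F ∩ finSubsets M := by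
    intro s hs
    obtain ⟨m, hm⟩ := exists_forall_lt s
    obtain ⟨_, hy, t, ht, rfl⟩ := mem_closure_iff_nhds.1 hx _ (setOf_agree_mem_nhds x m)
    refine (hF.inter (isHereditary_finSubsets M)).mem ht fun i hi => ?_
    have := hy i (hm i hi).le
    rw [hs i hi] at this
    simpa [charFun] using this
  refine ⟨{i | x i = true}, ⟨fun i hi => ?_, fun hfin => hxF ?_⟩, fun s hs => (key s hs).1⟩
  · have := (key {i} (by simpa using hi)).2
    exact this (by simp)
  · refine ⟨hfin.toFinset, key _ fun i hi => by simpa using hi, ?_⟩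
    ext i
    simp [charFun]

/-- One-point end extension inside a family. -/
def EndExtends (F : Set (Finset ℕ+)) (t s : Finset ℕ+) : Prop :=
  t ∈ F ∧ ∃ n, (∀ x ∈ s, x < n) ∧ t = insert n s

/-- An infinite chain converges to its union, which closedness forces to be finite although the
cardinalities increase strictly. -/
theorem wellFounded_endExtends (h : PointwiseClosed F) : WellFounded (EndExtends F) := by
  rw [wellFounded_iff_isEmpty_descending_chain]
  refine ⟨fun ⟨f, hf⟩ => ?_⟩
  have hss : ∀ k, f k ⊂ f (k + 1) := fun k => by
    obtain ⟨-, n, hn, heq⟩ := hf k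
    rw [heq]
    exact Finset.ssubset_insert fun h => (hn n h).false
  have hmono : StrictMono f := strictMono_nat_of_lt_succ hss
  classical
  -- The shift is needed because `f 0` need not lie in `F`.
  have hlim : Tendsto (fun k => charFun (f (k + 1))) atTop
      (𝓝 fun i => decide (∃ k, i ∈ f k)) := by
    refine tendsto_pi_nhds.2 fun i => ?_
    by_cases hi : ∃ k, i ∈ f k
    · obtain ⟨k, hk⟩ := hi
      refine tendsto_const_nhds.congr' ((eventually_ge_atTop k).mono fun j hj => ?_)
      have : i ∈ f (j + 1) := hmono.monotone (hj.trans j.le_succ) hk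
      simp only [charFun, this, decide_true, decide_eq_true_eq]
      exact ⟨k, hk⟩
    · refine tendsto_const_nhds.congr fun j => ?_
      have : i ∉ f (j + 1) := fun h => hi ⟨_, h⟩
      simp only [charFun, this, decide_false, decide_eq_false_iff_not]
      exact hi
  obtain ⟨s, -, hs⟩ := h.mem_of_tendsto hlim (Eventually.of_forall fun k => ⟨_, (hf k).1, rfl⟩)
  have hsub : ∀ k, f k ⊆ s := fun k i hi => by
    have := congrFun hs i
    simpa [charFun, show ∃ k, i ∈ f k from ⟨k, hi⟩] using this
  have hcard : StrictMono fun k => (f k).card := fun _ _ hjk => Finset.card_lt_card (hmono hjk)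
  have h1 := hcard.id_le (s.card + 1)
  have h2 := Finset.card_le_card (hsub (s.card + 1))
  simp only [id] at h1
  omega

/-- The derivatives of a pointwise closed family vanish at a common countable order. -/
theorem exists_strongDerivIter_eq_empty (hF : IsHereditary F)
    (h : PointwiseClosed (F ∩ finSubsets M)) : ∃ θ : Ordinal.{0}, θ < Ordinal.omega 1 ∧ 1 ≤ θ ∧
      ∀ L ∈ infSubsets M, strongDerivIter F L θ = ∅ := by
  have : IsWellFounded _ (EndExtends (F ∩ finSubsets M)) := ⟨wellFounded_endExtends h⟩
  let ρ : Finset ℕ+ → Ordinal.{0} := IsWellFounded.rank (EndExtends (F ∩ finSubsets M))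
  have hρ : ∀ t, ρ t < Ordinal.omega 1 := by
    intro t
    induction t using (wellFounded_endExtends h).induction with
    | _ t ih =>
      simp only [ρ] at ih ⊢
      rw [IsWellFounded.rank_eq]
      -- There are only countably many finite sets, so this is a countable supremum.
      exact Ordinal.iSup_lt_omega_one fun b =>
        (Cardinal.isSuccLimit_omega 1).succ_lt (ih b.1 b.2)
  -- The rank is computed on `M`, so the bound is uniform in `L`.
  have hle : ∀ L ∈ infSubsets M, ∀ t ξ, t ∈ strongDerivIter F L ξ → ξ ≤ ρ t := by
    intro L hL t
    induction t using (wellFounded_endExtends h).induction with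
    | _ t ih =>
      intro ξ ht
      by_contra! hlt
      obtain ⟨m, hm⟩ := exists_forall_lt t
      obtain ⟨n, hn, hmn, hmem⟩ := exists_insert_mem_strongDerivIter hF hL.2
        (strongDerivIter_antitone F L (Order.add_one_le_iff.2 hlt) ht) m
      have hr : EndExtends (F ∩ finSubsets M) (insert n t) t := by
        obtain ⟨h1, h2⟩ := strongDerivIter_subset F L _ hmem
        exact ⟨⟨h1, finSubsets_mono hL.1 h2⟩, n, fun x hx => (hm x hx).trans hmn, rfl⟩
      exact (ih _ hr _ hmem).not_gt (IsWellFounded.rank_lt_of_rel hr)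
  refine ⟨ρ ∅ + 1, (Cardinal.isSuccLimit_omega 1).succ_lt (hρ ∅), le_add_self, fun L hL => ?_⟩
  by_contra hne
  exact (hle L hL _ _ (empty_mem_strongDerivIter hF hL.2 hne)).not_gt (Order.lt_succ _)

end Closed

/-! ### The two extremal examples at order `ω` -/

section OmegaZero

open Ordinal

variable {F : Set (Finset ℕ+)} {L : Set ℕ+}

/-- As `ω = ω ^ 1`, such a set is a union of `min s` consecutive singletons. -/
theorem schreier_omega0_subset (c : LadderSystem) {s : Finset ℕ+} (hs : s ∈ schreier c ω) :
    ∃ h : s.Nonempty, s.card = s.min' h := by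
  have hω : cnfSum [1] = ω := by simp [cnfSum]
  rw [← hω, schreier_cnfSum c (List.pairwise_singleton _ _), List.map_singleton,
    blockUnions_singleton, ← zero_add (1 : Ordinal.{0}), mem_powerFamily_add_one] at hs
  obtain ⟨h, hs⟩ := hs
  refine ⟨h, ?_⟩
  generalize (s.min' h : ℕ) = k at hs
  clear h
  induction k generalizing s with
  | zero => simpa [blockUnions] using hs
  | succ k ih =>
    rw [List.replicate_succ, mem_blockUnions_cons] at hs
    obtain ⟨t, ht, u, hu, htu, rfl⟩ := hs
    obtain ⟨n, rfl⟩ := (mem_powerFamily_zero c).1 ht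
    rw [Finset.card_union_of_disjoint, ih hu, Finset.card_singleton, add_comm]
    exact Finset.disjoint_left.2 fun x hx hx' => (htu x hx x hx').false

theorem exists_card_eq_of_mem_strongDerivIter (hF : IsHereditary F) (hL : L.Infinite) (k : ℕ)
    {t : Finset ℕ+} (ht : t ∈ strongDerivIter F L k) :
    ∃ s, t ⊆ s ∧ s.card = t.card + k ∧ s ∈ F := by
  induction k generalizing t with
  | zero => exact ⟨t, subset_rfl, rfl, (strongDerivIter_subset F L _ ht).1⟩
  | succ k ih =>
    rw [Nat.cast_succ] at ht
    obtain ⟨m, hm⟩ := exists_forall_lt t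
    obtain ⟨n, -, hmn, hmem⟩ := exists_insert_mem_strongDerivIter hF hL ht m
    obtain ⟨s, hts, hcard, hs⟩ := ih hmem
    refine ⟨s, (Finset.subset_insert n t).trans hts, ?_, hs⟩
    rw [hcard, Finset.card_insert_of_notMem fun h => (hm n h).not_gt hmn]
    omega

/-- Adding a large point raises the cardinality by at most one while using up one derivation, so the
bound on `card + k` persists. -/
theorem mem_strongDerivIter_of_card_lt (hF : IsHereditary F) (hL : L.Infinite)
    (hbig : ∀ s : Finset ℕ+, (∀ x ∈ s, s.card < (x : ℕ)) → s ∈ F) (k : ℕ)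
    {t : Finset ℕ+} (ht : t ∈ finSubsets L) (h : ∀ x ∈ t, t.card + k < (x : ℕ)) :
    t ∈ strongDerivIter F L k := by
  induction k generalizing t with
  | zero =>
    rw [Nat.cast_zero, strongDerivIter_zero]
    exact ⟨hbig t h, ht⟩
  | succ k ih =>
    rw [Nat.cast_succ, mem_strongDerivIter_add_one hF hL]
    refine ⟨ht, (Set.finite_Iic (⟨t.card + k + 1, Nat.succ_pos _⟩ : ℕ+)).subset fun n hn => ?_⟩
    by_contra hlt
    have hlt : t.card + k + 1 < (n : ℕ) := not_le.1 hlt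
    refine hn.2 (ih (insert_mem_finSubsets hn.1 ht) fun x hx => ?_)
    have hcard : (insert n t).card + k ≤ t.card + k + 1 :=
      (add_le_add_left (Finset.card_insert_le n t) k).trans_eq (add_right_comm _ _ _)
    refine hcard.trans_lt ?_
    rcases Finset.mem_insert.1 hx with rfl | hx
    exacts [hlt, h x hx]

/-- A hereditary family between `{s | s.card < min s}` and `{s | s.card ≤ min s}` is pointwise
closed and all of its strong Cantor-Bendixson indices are `ω + 1`. -/
theorem supIndex_eq_omega0_add_one (hF : IsHereditary F)
    (hsmall : ∀ s ∈ F, ∀ x ∈ s, s.card ≤ (x : ℕ))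
    (hbig : ∀ s : Finset ℕ+, (∀ x ∈ s, s.card < (x : ℕ)) → s ∈ F) :
    PointwiseClosed (F ∩ finSubsets univ) ∧ supIndex F univ = ω + 1 := by
  have hempty : ∀ L : Set ℕ+, L.Infinite → strongDerivIter F L (ω + 1) = ∅ := by
    intro L hL
    by_contra hne
    -- Then `{n}` would survive `ω`, hence `n`, derivations and extend to a member of `F` with `n +
    -- 1` elements, one of them `n`.
    obtain ⟨n, -, -, hn⟩ := exists_insert_mem_strongDerivIter hF hL
      (empty_mem_strongDerivIter hF hL hne) 1
    obtain ⟨s, hs, hcard, hsF⟩ := exists_card_eq_of_mem_strongDerivIter hF hL n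
      (strongDerivIter_antitone F L (natCast_lt_omega0 n).le hn)
    have := hsmall s hsF n (hs (Finset.mem_insert_self n ∅))
    rw [hcard] at this
    simp at this
  have hne : strongDerivIter F univ ω ≠ ∅ := by
    refine Set.nonempty_iff_ne_empty.1 ⟨∅, (mem_strongDerivIter_limit isSuccLimit_omega0).2 ?_⟩
    intro β hβ
    obtain ⟨k, rfl⟩ := lt_omega0.1 hβ
    exact mem_strongDerivIter_of_card_lt hF infinite_univ hbig k (empty_mem_finSubsets _) (by simp)
  constructor
  · by_contra hcl
    obtain ⟨L, ⟨-, hL⟩, hLF⟩ := exists_finSubsets_subset hF hcl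
    obtain ⟨n, hn⟩ := hL.nonempty
    obtain ⟨s, hs, hcard⟩ := hL.exists_subset_card_eq ((n : ℕ) + 1)
    have h1 := hsmall _ (hLF (insert_mem_finSubsets hn hs)) n (Finset.mem_insert_self n s)
    have h2 := Finset.card_le_card (Finset.subset_insert n s)
    omega
  · refine le_antisymm (ciSup_le' fun L => strongIndex_le le_add_self (hempty _ L.2.2)) ?_
    exact (Order.add_one_le_iff.2 (lt_strongIndex (hempty _ infinite_univ) hne)).trans
      (strongIndex_le_supIndex ⟨subset_rfl, infinite_univ⟩)

theorem isHereditary_card_le : IsHereditary {s : Finset ℕ+ | ∀ x ∈ s, s.card ≤ (x : ℕ)} :=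
  isHereditary_iff.2 fun _ hs _ hts x hx => (Finset.card_le_card hts).trans (hs x (hts hx))

theorem isHereditary_card_lt : IsHereditary {s : Finset ℕ+ | ∀ x ∈ s, s.card < (x : ℕ)} :=
  isHereditary_iff.2 fun _ hs _ hts x hx => (Finset.card_le_card hts).trans_lt (hs x (hts hx))

end OmegaZero

end ThinSchreier

/-! ### Assembly of the theorem -/

open ThinSchreier
theorem theorem3p7 (c : LadderSystem) :
    (∀ (F : Set (Finset ℕ+)) (M : Set ℕ+), IsHereditary F → M.Infinite →
      (¬ PointwiseClosed (F ∩ finSubsets M) → ∃ L ∈ infSubsets M, finSubsets L ⊆ F) ∧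
      (PointwiseClosed (F ∩ finSubsets M) →
        (∀ L ∈ infSubsets M, ∃ ξ : Ordinal.{0}, ξ < Ordinal.omega 1 ∧
          strongDerivIter F L ξ = ∅) ∧
        supIndex F M < Ordinal.omega 1 ∧
        (∀ ξ : Ordinal.{0}, ξ < Ordinal.omega 1 → ξ + 1 < supIndex F M →
          ∃ L ∈ infSubsets M, schreier c ξ ∩ finSubsets L ⊆ F) ∧
        (∀ ξ : Ordinal.{0}, ξ < Ordinal.omega 1 → supIndex F M < ξ + 1 →
          (∀ I ∈ infSubsets M, ∃ L ∈ infSubsets I, schreier c ξ ∩ finSubsets L ⊆ Fᶜ) ∧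
          (∀ L ∈ infSubsets M,
            (schreier c ξ ∩ finSubsets L ⊆ Fᶜ ↔
              F ∩ finSubsets L ⊆ initialSegments (schreier c ξ) \ schreier c ξ))) ∧
        (∀ ξ : Ordinal.{0}, ξ < Ordinal.omega 1 → supIndex F M = ξ + 1 →
          ∃ L ∈ infSubsets M,
            schreier c ξ ∩ finSubsets L ⊆ F ∨ schreier c ξ ∩ finSubsets L ⊆ Fᶜ))) ∧
    (∃ (M : Set ℕ+) (ξ : Ordinal.{0}), M.Infinite ∧ ξ < Ordinal.omega 1 ∧
      (∃ F : Set (Finset ℕ+), F.Nonempty ∧ IsHereditary F ∧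
        PointwiseClosed (F ∩ finSubsets M) ∧ supIndex F M = ξ + 1 ∧
        ∀ L ∈ infSubsets M, schreier c ξ ∩ finSubsets L ⊆ F) ∧
      (∃ F : Set (Finset ℕ+), F.Nonempty ∧ IsHereditary F ∧
        PointwiseClosed (F ∩ finSubsets M) ∧ supIndex F M = ξ + 1 ∧
        ∀ L ∈ infSubsets M, schreier c ξ ∩ finSubsets L ⊆ Fᶜ)) := by
  refine ⟨fun F M hF hM => ⟨exists_finSubsets_subset hF, fun hcl => ?_⟩, univ, Ordinal.omega0,
    infinite_univ, Ordinal.omega0_lt_omega_one, ⟨_, ⟨∅, ?_⟩, isHereditary_card_le, ?_⟩,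
    ⟨_, ⟨∅, ?_⟩, isHereditary_card_lt, ?_⟩⟩
  · obtain ⟨θ, hθ, hθ1, hempty⟩ := exists_strongDerivIter_eq_empty hF hcl
    refine ⟨fun L hL => ⟨θ, hθ, hempty L hL⟩, ?_, fun ξ hξ hlt => ?_, fun ξ hξ hlt =>
      ⟨fun I hI => ?_, fun L _ => schreier_subset_compl_iff c hF hξ L⟩,
      fun ξ hξ _ => exists_homogeneous c ξ hξ F M hM⟩
    · exact (ciSup_le' fun L : infSubsets M =>
        strongIndex_le hθ1 (hempty L L.2)).trans_lt hθ
    · obtain ⟨⟨L, hL⟩, hlt⟩ := (lt_ciSup_iff' Ordinal.bddAbove_of_small).1 hlt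
      have hne := strongDerivIter_ne_empty_of_lt le_add_self hlt
      -- The derivative of order `ξ + 1` is nonempty on `L`, hence on every infinite `K ⊆ L`, which
      -- rules out avoidance.
      obtain ⟨K, hK, h | h⟩ := exists_homogeneous c ξ hξ F L hL.2
      · exact ⟨K, ⟨hK.1.trans hL.1, hK.2⟩, h⟩
      · have := mem_strongDerivIter_of_subset hF hL.2 hK.2 hK.1 _
          (empty_mem_strongDerivIter hF hL.2 hne) (empty_mem_finSubsets K)
        rw [strongDerivIter_eq_empty_of_schreier_subset_compl c hF hK.2 hξ h] at this
        exact this.elim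
    -- Inclusion on `L` would make the index there at least `ξ + 1`, above the supremum.
    · obtain ⟨L, hL, h | h⟩ := exists_homogeneous c ξ hξ F I hI.2
      · have hLM : L ∈ infSubsets M := ⟨hL.1.trans hI.1, hL.2⟩
        have := lt_strongIndex (hempty L hLM)
          (strongDerivIter_ne_empty_of_schreier_subset c hF hL.2 hξ h)
        exact absurd ((Order.add_one_le_iff.2 this).trans (strongIndex_le_supIndex hLM)) hlt.not_ge
      · exact ⟨L, hL, h⟩
  · simp
  · obtain ⟨h1, h2⟩ := supIndex_eq_omega0_add_one isHereditary_card_le (fun s hs => hs)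
      (fun s hs x hx => (hs x hx).le)
    refine ⟨h1, h2, fun L _ s hs x hx => ?_⟩
    obtain ⟨h, hcard⟩ := schreier_omega0_subset c hs.1
    exact hcard.le.trans (s.min'_le x hx)
  · simp
  · obtain ⟨h1, h2⟩ := supIndex_eq_omega0_add_one isHereditary_card_lt
      (fun s hs x hx => (hs x hx).le) (fun s hs => hs)
    refine ⟨h1, h2, fun L _ s hs hs' => ?_⟩
    obtain ⟨h, hcard⟩ := schreier_omega0_subset c hs.1
    exact (hs' _ (s.min'_mem h)).ne hcard
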